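/- Let $E$ and $F$ be real Banach spaces, $M\subset F$ open, $J\subset\mathbb R$ a bounded open interval, and let $$\omega\colon M\times J\to\mathcal L(F\times\mathbb R,\operatorname{End}(E))$$ be a bounded $C^1$ function, regarded as (the connection form of) a linear connection on the trivial Banach bundle with fiber $E$ over $M\times J$; here $\operatorname{End}(E)$ is the Banach space of continuous linear maps $E\to E$. Let $\omega_2\colon M\times J\to\mathcal L(\mathbb R,\operatorname{End}(E))$, $\omega_2(p)(s)=\omega(p)(0,s)$, be the second component of $\omega$, and assume that its partial derivative $D_1\omega_2$ in the direction of $F$ is bounded on $M\times J$. For a piecewise $C^1$ path $\gamma\colon[a,b]\to M\times J$ (that is, $\gamma$ is $C^1$ on each closed interval of some finite partition of $[a,b]$), a parallel section along $\gamma$ is a continuous map $\sigma\colon[a,b]\to E$ with $\sigma'(t)=-\omega(\gamma(t))(\gamma'(t))\,\sigma(t)$ for all but finitely many $t$, and the parallel transport $P_\gamma$ along $\gamma$ is the map $E\to E$ that sends $\sigma(a)$ to $\sigma(b)$ for every parallel section $\sigma$ along $\gamma$. Then there is a nondecreasing $C^\infty$ function $\beta\colon\mathbb R\to(0,\infty)$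 such that, for all real numbers $a\le b$ and every piecewise $C^1$ path $\gamma\colon[a,b]\to M\times J$, every vector in $E$ is the initial value $\sigma(a)$ of a parallel section $\sigma$ along $\gamma$, the parallel transport $P_\gamma$ is a well-defined continuous linear map $E\to E$, and $$\|P_\gamma\|\le\beta(L(\gamma_1)),$$ where $\gamma_1$ is the projection of $\gamma$ to $F$ and $L(\gamma_1)$ is its arc length (total variation). -/

import Mathlib

set_option maxSynthPendingDepth 3

open Set


section ParallelTransport

variable {E F X : Type*} [NormedAddCommGroup E] [NormedSpace ℝ E]
  [NormedAddCommGroup F] [NormedSpace ℝ F] [NormedAddCommGroup X] [NormedSpace ℝ X]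

/-- `γ` is piecewise `C¹` on `[a, b]`: there is a finite strictly increasing sequence
`a = t 0 < t 1 < ⋯ < t m = b` such that the restriction of `γ` to each closed interval
`[t i, t (i + 1)]` is of class `C¹` (one-sided derivatives at the end points).
For `a = b` (where `m = 0`) there is no condition; for `b < a` there is no such path. -/
def IsPiecewiseC1 (a b : ℝ) (γ : ℝ → X) : Prop :=
  ∃ (m : ℕ) (t : ℕ → ℝ), t 0 = a ∧ t m = b ∧
    ∀ i < m, t i < t (i + 1) ∧ ContDiffOn ℝ 1 γ (Icc (t i) (t (i + 1)))

/-- The arc length of a path `c` on `[a, b]`, that is, its total variation. -/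
noncomputable def arcLength (a b : ℝ) (c : ℝ → X) : ℝ :=
  (eVariationOn c (Icc a b)).toReal

/-- The second component `ω₂` of the connection form `ω`, according to the decomposition
`L(F × ℝ, End E) ≅ L(F, End E) ⊕ L(ℝ, End E)`. -/
noncomputable def secondComponent (ω : F × ℝ → (F × ℝ →L[ℝ] (E →L[ℝ] E))) (p : F × ℝ) :
    ℝ →L[ℝ] (E →L[ℝ] E) :=
  (ω p).comp (ContinuousLinearMap.inr ℝ F ℝ)

/-- The partial derivative `D₁ω₂` of the second component in the direction of `F`. -/
noncomputable def partialSecondComponent (ω : F × ℝ → (F × ℝ →L[ℝ] (E →L[ℝ] E))) (p : F × ℝ) :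
    F →L[ℝ] (ℝ →L[ℝ] (E →L[ℝ] E)) :=
  fderiv ℝ (fun x : F => secondComponent ω (x, p.2)) p.1

/-- `σ` is a parallel section along the piecewise `C¹` path `γ : [a, b] → X` in the trivial bundle
with fiber `E`, with respect to the linear connection with connection form `ω`: `σ` is continuous
on `[a, b]` and its covariant derivative `σ' + ω(γ)(γ') σ` along `γ` vanishes at all
but finitely many points.  (The finitely many points where `γ` has a corner may be
put into the exceptional set, so the convention for `deriv` there does not matter.) -/
def IsParallelAlong (ω : X → (X →L[ℝ] (E →L[ℝ] E))) (a b : ℝ) (γ : ℝ → X) (σ : ℝ → E) : Prop :=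
  ContinuousOn σ (Icc a b) ∧
    ∃ S : Set ℝ, S.Finite ∧ ∀ t ∈ Ioo a b \ S,
      HasDerivAt σ (-(ω (γ t) (deriv γ t) (σ t))) t

/-- `P` is the parallel transport along `γ : [a, b] → X` from the fiber over `γ a` to the fiber
over `γ b` (both are `E`), with respect to `ω`: every vector in the fiber over `γ a` is the
initial value of a parallel section along `γ`, and `P` sends the initial value of every parallel
section along `γ` to its final value. -/
def IsParallelTransport (ω : X → (X →L[ℝ] (E →L[ℝ] E))) (a b : ℝ) (γ : ℝ → X)
    (P : E →L[ℝ] E) : Prop :=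
  (∀ v : E, ∃ σ : ℝ → E, IsParallelAlong ω a b γ σ ∧ σ a = v) ∧
    ∀ σ : ℝ → E, IsParallelAlong ω a b γ σ → P (σ a) = σ b

/-- There is at most one parallel transport along a given path. -/
theorem IsParallelTransport.unique {ω : X → (X →L[ℝ] (E →L[ℝ] E))} {a b : ℝ} {γ : ℝ → X}
    {P Q : E →L[ℝ] E} (hP : IsParallelTransport ω a b γ P) (hQ : IsParallelTransport ω a b γ Q) :
    P = Q := by
  ext v
  obtain ⟨σ, hσ, rfl⟩ := hP.1 v
  rw [hP.2 σ hσ, hQ.2 σ hσ]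

end ParallelTransport

/-!
Write `A(x, s) = ω₂(x, s)(1)`. A parallel section along `γ = (γ₁, γ₂)` satisfies
`σ' = -ω(γ)(γ₁', 0) σ - γ₂' A(γ) σ`, and only the second term can make its norm grow with the
length of `γ₂`. That term is removed by a change of gauge. For fixed `x`, let `H(x, ·)` solve
`∂ₛH = H A` with `H = 1` at one end `p` of a compact interval `[p, q] ⊆ J` that contains the
values of `γ₂`. Since `J` is bounded, `H` and its inverse are bounded by `exp (B |J|)`, where
`B` bounds `ω`; since `D₁ω₂` is bounded, Grönwall's inequality shows that `H` is locally Lipschitz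
in `x` with a constant that does not depend on `γ` (`exists_verticalGauge`).

For `τ = H(γ) σ` the contributions of `γ₂'` cancel, so `τ` varies at a rate at most
`K ‖γ₁'‖ ‖τ‖`. As `H` is only known to be Lipschitz in `x`, this is proved as a bound for the
upper right derivative of `‖τ‖ exp (-K V)`, with `V` the variation of `γ₁` up to the current time
(`eventually_slope_discounted_norm_lt`); the increments of `V` dominate those of `γ₁`, so no
formula for arc length as an integral is needed. A mean value inequality that tolerates finitely
many exceptional points (`le_of_frequently_slope_lt_off_finite`) gives
`‖σ(b)‖ ≤ exp (2 B |J|) exp (K L(γ₁)) ‖σ(a)‖`, that is, `β(x) = exp (2 B |J|) exp (K x)`.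

The same estimate, applied to differences, gives uniqueness of parallel sections and hence
linearity of parallel transport. Existence comes from the Dyson series of a linear equation on
each `C¹` piece (`exists_hasDerivAt_linear`), glued along the subdivision.
-/

open Filter Topology MeasureTheory

/-! ### Linear differential equations and a mean value inequality -/

/-- The first-order system `u' = A(t) u` with bounded continuous coefficient has a solution on
the whole line with any prescribed initial value: the Dyson series `∑ uₙ` with `u₀ = v` and
`uₙ₊₁(t) = ∫ A uₙ` converges, since `‖uₙ(t)‖ ≤ ‖v‖ (K |t - t₀|)ⁿ / n!`. -/
theorem exists_hasDerivAt_linear {G : Type*} [NormedAddCommGroup G] [NormedSpace ℝ G]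
    [CompleteSpace G] {A : ℝ → G →L[ℝ] G} (hA : Continuous A) {K : ℝ} (hK : ∀ t, ‖A t‖ ≤ K)
    (t₀ : ℝ) (v : G) :
    ∃ u : ℝ → G, u t₀ = v ∧ ∀ t, HasDerivAt u (A t (u t)) t := by
  have hK0 : 0 ≤ K := (norm_nonneg _).trans (hK t₀)
  let f : ℕ → ℝ → G := fun n => Nat.rec (fun _ => v) (fun _ g t => ∫ s in t₀..t, A s (g s)) n
  have hf0 : ∀ t, f 0 t = v := fun _ => rfl
  have hfs : ∀ n t, f (n + 1) t = ∫ s in t₀..t, A s (f n s) := fun _ _ => rfl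
  have hder' : ∀ n, Continuous (f n) → ∀ t, HasDerivAt (f (n + 1)) (A t (f n t)) t := by
    intro n hn t
    exact ((hA.clm_apply hn).integral_hasStrictDerivAt t₀ t).hasDerivAt
  have hcont : ∀ n, Continuous (f n) := by
    intro n
    induction n with
    | zero => exact continuous_const
    | succ n ih => exact continuous_iff_continuousAt.2 fun t => (hder' n ih t).continuousAt
  have hder : ∀ n t, HasDerivAt (f (n + 1)) (A t (f n t)) t := fun n => hder' n (hcont n)
  have hbd : ∀ n t, ‖f n t‖ ≤ ‖v‖ * (K * |t - t₀|) ^ n / n.factorial := by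
    intro n
    induction n with
    | zero => intro t; simp [hf0]
    | succ n ih =>
      intro t
      rw [hfs, intervalIntegral.norm_intervalIntegral_eq]
      calc ‖∫ s in Set.uIoc t₀ t, A s (f n s)‖
          ≤ ∫ s in Set.uIoc t₀ t, ‖v‖ * K ^ (n + 1) / n.factorial * |s - t₀| ^ n := by
            refine norm_integral_le_of_norm_le ?_ (Eventually.of_forall fun s => ?_)
            · exact (Continuous.integrableOn_uIoc (by fun_prop))
            · calc ‖A s (f n s)‖ ≤ K * (‖v‖ * (K * |s - t₀|) ^ n / n.factorial) :=
                    ((A s).le_opNorm _).trans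
                      (mul_le_mul (hK s) (ih s) (norm_nonneg _) hK0)
                _ = _ := by rw [mul_pow]; ring
        _ = ‖v‖ * (K * |t - t₀|) ^ (n + 1) / (n + 1).factorial := by
            rw [integral_const_mul, integral_pow_abs_sub_uIoc, mul_pow, Nat.factorial_succ]
            push_cast
            field_simp
  have hsum : ∀ t, Summable fun n => f n t := fun t => by
    refine Summable.of_norm_bounded (g := fun n => ‖v‖ * (K * |t - t₀|) ^ n / n.factorial) ?_
      (fun n => hbd n t)
    simpa only [mul_div_assoc] using (Real.summable_pow_div_factorial (K * |t - t₀|)).mul_left ‖v‖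
  refine ⟨fun t => v + ∑' n, f (n + 1) t, by simp [hfs], fun t => ?_⟩
  have hval : A t (v + ∑' n, f (n + 1) t) = ∑' n, A t (f n t) := by
    rw [← (A t).map_tsum (hsum t), (hsum t).tsum_eq_zero_add, hf0]
  rw [hval]
  have hmem : t ∈ Metric.ball t₀ (|t - t₀| + 1) := by
    rw [Metric.mem_ball, Real.dist_eq]; linarith
  refine HasDerivAt.const_add v (hasDerivAt_tsum_of_isPreconnected
    (u := fun n => K * (‖v‖ * (K * (|t - t₀| + 1)) ^ n / n.factorial)) ?_ Metric.isOpen_ball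
    (convex_ball t₀ (|t - t₀| + 1)).isPreconnected (fun n y _ => hder n y) ?_ hmem
    ((summable_nat_add_iff 1).2 (hsum t)) hmem)
  · refine Summable.mul_left _ ?_
    simpa only [mul_div_assoc] using
      (Real.summable_pow_div_factorial (K * (|t - t₀| + 1))).mul_left ‖v‖
  · intro n y hy
    rw [Metric.mem_ball, Real.dist_eq] at hy
    refine ((A y).le_opNorm _).trans (mul_le_mul (hK y) ((hbd n y).trans ?_) (norm_nonneg _) hK0)
    gcongr

/-- A continuous function whose lower right Dini derivative is nonpositive off a finite set does
not increase from one end of the interval to the other. -/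
theorem le_of_frequently_slope_lt_off_finite {f : ℝ → ℝ} {S : Set ℝ} (hS : S.Finite) :
    ∀ {a b : ℝ}, a ≤ b → ContinuousOn f (Icc a b) →
      (∀ x ∈ Ioo a b \ S, ∀ r > 0, ∃ᶠ z in 𝓝[>] x, slope f x z < r) → f b ≤ f a := by
  induction S, hS using Set.Finite.induction_on with
  | empty =>
    intro a b hab hf h
    rcases hab.eq_or_lt with rfl | hab
    · exact le_rfl
    -- The mean value inequality applies from interior points on; let them tend to `a`.
    have key : ∀ s ∈ Ioo a b, ∀ t ∈ Ioo a b, s ≤ t → f t ≤ f s := by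
      intro s hs t ht hst
      refine image_le_of_liminf_slope_right_le_deriv_boundary (f := f) (a := s) (b := t)
        (B := fun _ => f s) (B' := fun _ => 0) (hf.mono (Icc_subset_Icc hs.1.le ht.2.le)) le_rfl
        continuousOn_const (fun x _ => hasDerivWithinAt_const _ _ _) ?_ (right_mem_Icc.2 hst)
      intro x hx r hr
      exact h x ⟨⟨hs.1.trans_le hx.1, hx.2.trans ht.2⟩, fun hx => hx⟩ r hr
    have ha : Tendsto f (𝓝[>] a) (𝓝 (f a)) := by
      have := (hf a (left_mem_Icc.2 hab.le)).mono Ioo_subset_Icc_self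
      rwa [ContinuousWithinAt, nhdsWithin_Ioo_eq_nhdsGT hab] at this
    have hb : Tendsto f (𝓝[<] b) (𝓝 (f b)) := by
      have := (hf b (right_mem_Icc.2 hab.le)).mono Ioo_subset_Icc_self
      rwa [ContinuousWithinAt, nhdsWithin_Ioo_eq_nhdsLT hab] at this
    refine le_of_tendsto hb ?_
    filter_upwards [Ioo_mem_nhdsLT hab] with t ht
    refine ge_of_tendsto ha ?_
    filter_upwards [Ioo_mem_nhdsGT ht.1] with s hs
    exact key s ⟨hs.1, hs.2.trans ht.2⟩ t ht hs.2.le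
  | @insert c S _ _ ih =>
    intro a b hab hf h
    by_cases hc : c ∈ Ioo a b
    · refine (ih hc.2.le (hf.mono (Icc_subset_Icc_left hc.1.le)) ?_).trans
        (ih hc.1.le (hf.mono (Icc_subset_Icc_right hc.2.le)) ?_)
      · intro x hx
        exact h x ⟨⟨hc.1.trans hx.1.1, hx.1.2⟩, fun hx' => hx'.elim (fun e => hx.1.1.ne' e) hx.2⟩
      · intro x hx
        exact h x ⟨⟨hx.1.1, hx.1.2.trans hc.2⟩, fun hx' => hx'.elim (fun e => hx.1.2.ne e) hx.2⟩
    · refine ih hab hf fun x hx => h x ⟨hx.1, fun hx' => hx'.elim (fun e => hc (e ▸ hx.1)) hx.2⟩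

/-! ### Fundamental solutions in the operator algebra -/

section Fundamental

variable {E : Type*} [NormedAddCommGroup E] [NormedSpace ℝ E]

/-- The fundamental solution `h` of `h' = h A`, normalized at `p`. -/
theorem exists_hasDerivAt_mul_right [CompleteSpace E] {A : ℝ → E →L[ℝ] E} (hA : Continuous A)
    {K : ℝ} (hK : ∀ t, ‖A t‖ ≤ K) (p : ℝ) :
    ∃ h : ℝ → E →L[ℝ] E, h p = 1 ∧ ∀ s, HasDerivAt h (h s * A s) s := by
  let R := (ContinuousLinearMap.mul ℝ (E →L[ℝ] E)).flip
  have hR : ∀ x, ‖R x‖ ≤ ‖x‖ := fun x =>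
    ContinuousLinearMap.opNorm_le_bound _ (norm_nonneg _) fun y => by
      simpa [R, mul_comm ‖x‖] using norm_mul_le y x
  obtain ⟨h, hp, hh⟩ := exists_hasDerivAt_linear (A := fun t => R (A t)) (R.continuous.comp hA)
    (fun t => (hR _).trans (hK t)) p 1
  exact ⟨h, hp, hh⟩

/-- The solution of `k' = -A k`, normalized at `p`. -/
theorem exists_hasDerivAt_neg_mul_left [CompleteSpace E] {A : ℝ → E →L[ℝ] E} (hA : Continuous A)
    {K : ℝ} (hK : ∀ t, ‖A t‖ ≤ K) (p : ℝ) :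
    ∃ k : ℝ → E →L[ℝ] E, k p = 1 ∧ ∀ s, HasDerivAt k (-(A s * k s)) s := by
  let L := ContinuousLinearMap.mul ℝ (E →L[ℝ] E)
  have hL : ∀ x, ‖L x‖ ≤ ‖x‖ := fun x =>
    ContinuousLinearMap.opNorm_le_bound _ (norm_nonneg _) fun y => norm_mul_le x y
  obtain ⟨k, hp, hk⟩ := exists_hasDerivAt_linear (A := fun t => -L (A t))
    (L.continuous.comp hA).neg (fun t => (norm_neg _).trans_le ((hL _).trans (hK t))) p 1
  exact ⟨k, hp, hk⟩

theorem norm_le_exp_of_hasDerivAt {G : Type*} [NormedAddCommGroup G] [NormedSpace ℝ G]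
    {h h' : ℝ → G} {K p s : ℝ} (hp : ‖h p‖ ≤ 1) (hh : ∀ s, HasDerivAt h (h' s) s)
    (hK : ∀ s, ‖h' s‖ ≤ K * ‖h s‖) (hps : p ≤ s) : ‖h s‖ ≤ Real.exp (K * (s - p)) := by
  have := norm_le_gronwallBound_of_norm_deriv_right_le (f := h) (f' := h') (δ := 1) (K := K)
    (ε := 0) (a := p) (b := s) (fun t _ => (hh t).continuousAt.continuousWithinAt)
    (fun t _ => (hh t).hasDerivWithinAt) hp (fun t _ => by simpa using hK t) s
    (right_mem_Icc.2 hps)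
  simpa [gronwallBound_ε0] using this

theorem norm_one_clm_le : ‖(1 : E →L[ℝ] E)‖ ≤ 1 := ContinuousLinearMap.norm_id_le

theorem norm_fundamental_le {A h : ℝ → E →L[ℝ] E} {K : ℝ} (hK : ∀ t, ‖A t‖ ≤ K) {p s : ℝ}
    (hp : h p = 1) (hh : ∀ s, HasDerivAt h (h s * A s) s) (hps : p ≤ s) :
    ‖h s‖ ≤ Real.exp (K * (s - p)) := by
  refine norm_le_exp_of_hasDerivAt (by rw [hp]; exact norm_one_clm_le) hh (fun t => ?_) hps
  rw [mul_comm K]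
  exact (norm_mul_le _ _).trans (by gcongr; exact hK t)

/-- The fundamental solution `h` is bounded below, because the solution `k` of `k' = -A k` is a
left inverse of it: `k h - 1` solves the linear equation `D' = -A D + D A` and vanishes at `p`. -/
theorem norm_le_mul_norm_fundamental_apply [CompleteSpace E] {A h : ℝ → E →L[ℝ] E}
    (hA : Continuous A) {K : ℝ} (hK : ∀ t, ‖A t‖ ≤ K) {p s : ℝ} (hp : h p = 1)
    (hh : ∀ s, HasDerivAt h (h s * A s) s) (hps : p ≤ s) (v : E) :
    ‖v‖ ≤ Real.exp (K * (s - p)) * ‖h s v‖ := by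
  obtain ⟨k, kp, hk⟩ := exists_hasDerivAt_neg_mul_left hA hK p
  have hks : ‖k s‖ ≤ Real.exp (K * (s - p)) := by
    refine norm_le_exp_of_hasDerivAt (by rw [kp]; exact norm_one_clm_le) hk (fun t => ?_) hps
    rw [norm_neg]
    exact (norm_mul_le _ _).trans (by gcongr; exact hK t)
  have hD : ∀ t, HasDerivAt (fun t => k t * h t - 1)
      (-(A t * (k t * h t - 1)) + (k t * h t - 1) * A t) t := by
    intro t
    have e : -(A t * (k t * h t - 1)) + (k t * h t - 1) * A t
        = -(A t * k t) * h t + k t * (h t * A t) := by noncomm_ring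
    rw [e]
    exact ((hk t).mul (hh t)).sub_const 1
  have hinv : k s * h s - 1 = 0 := by
    have := norm_le_gronwallBound_of_norm_deriv_right_le (δ := 0) (K := 2 * K)
      (ε := 0) (a := p) (b := s) (fun t _ => (hD t).continuousAt.continuousWithinAt)
      (fun t _ => (hD t).hasDerivWithinAt) (by simp [hp, kp]) (fun t _ => by
        refine (norm_add_le _ _).trans ?_
        rw [norm_neg, add_zero, two_mul, add_mul]
        refine add_le_add ((norm_mul_le _ _).trans ?_) ((norm_mul_le _ _).trans ?_)
        · gcongr; exact hK t
        · rw [mul_comm]; gcongr; exact hK t) s (right_mem_Icc.2 hps)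
    rw [gronwallBound_ε0_δ0] at this
    exact norm_le_zero_iff.1 this
  calc ‖v‖ = ‖(k s * h s) v‖ := by rw [sub_eq_zero.1 hinv]; rfl
    _ ≤ ‖k s‖ * ‖h s v‖ := (k s).le_opNorm _
    _ ≤ _ := by gcongr

/-- Lipschitz dependence of the fundamental solution on the coefficient. -/
theorem norm_fundamental_sub_le {A₁ A₂ h₁ h₂ : ℝ → E →L[ℝ] E} {K : ℝ} (hK1 : 1 ≤ K)
    (hK₁ : ∀ t, ‖A₁ t‖ ≤ K) (hK₂ : ∀ t, ‖A₂ t‖ ≤ K) {p s ℓ δ : ℝ}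
    (hp₁ : h₁ p = 1) (hp₂ : h₂ p = 1)
    (hh₁ : ∀ s, HasDerivAt h₁ (h₁ s * A₁ s) s) (hh₂ : ∀ s, HasDerivAt h₂ (h₂ s * A₂ s) s)
    (hps : p ≤ s) (hℓ : s - p ≤ ℓ) (hδ : ∀ t, ‖A₁ t - A₂ t‖ ≤ δ) :
    ‖h₁ s - h₂ s‖ ≤ Real.exp (K * ℓ) ^ 2 * δ := by
  have hK0 : 0 < K := one_pos.trans_le hK1
  have hδ0 : 0 ≤ δ := (norm_nonneg _).trans (hδ p)
  have hD : ∀ t, HasDerivAt (fun t => h₁ t - h₂ t)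
      ((h₁ t - h₂ t) * A₁ t + h₂ t * (A₁ t - A₂ t)) t := by
    intro t
    have e : (h₁ t - h₂ t) * A₁ t + h₂ t * (A₁ t - A₂ t) = h₁ t * A₁ t - h₂ t * A₂ t := by
      noncomm_ring
    rw [e]
    exact (hh₁ t).sub (hh₂ t)
  have := norm_le_gronwallBound_of_norm_deriv_right_le (δ := 0) (K := K)
    (ε := Real.exp (K * ℓ) * δ) (a := p) (b := s)
    (fun t _ => (hD t).continuousAt.continuousWithinAt)
    (fun t _ => (hD t).hasDerivWithinAt) (by simp [hp₁, hp₂]) (fun t ht => by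
      refine (norm_add_le _ _).trans (add_le_add ((norm_mul_le _ _).trans ?_)
        ((norm_mul_le _ _).trans ?_))
      · rw [mul_comm]; gcongr; exact hK₁ t
      · gcongr
        · refine (norm_fundamental_le hK₂ hp₂ hh₂ ht.1).trans ?_
          gcongr
          linarith [ht.2]
        · exact hδ t) s (right_mem_Icc.2 hps)
  refine this.trans ?_
  simp only [gronwallBound_of_K_ne_0 hK0.ne', zero_mul, zero_add]
  calc Real.exp (K * ℓ) * δ / K * (Real.exp (K * (s - p)) - 1)
      ≤ Real.exp (K * ℓ) * δ * Real.exp (K * ℓ) := by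
        have h1 : 1 ≤ Real.exp (K * (s - p)) :=
          Real.one_le_exp (mul_nonneg hK0.le (sub_nonneg.2 hps))
        refine mul_le_mul (div_le_self (by positivity) hK1) ?_ (by linarith) (by positivity)
        have : Real.exp (K * (s - p)) ≤ Real.exp (K * ℓ) := by gcongr
        linarith
    _ = _ := by ring

end Fundamental

/-! ### Piecewise `C¹` paths and parallel sections along them -/

theorem LipschitzOnWith.Icc_union {Y : Type*} [PseudoMetricSpace Y] {γ : ℝ → Y}
    {C : NNReal} {a c b : ℝ} (h₁ : LipschitzOnWith C γ (Icc a c)) (h₂ : LipschitzOnWith C γ (Icc c b)) :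
    LipschitzOnWith C γ (Icc a b) := by
  have key : ∀ s ∈ Icc a b, ∀ t ∈ Icc a b, s ≤ t → dist (γ s) (γ t) ≤ C * dist s t := by
    intro s hs t ht hst
    rcases le_total t c with htc | hct
    · exact h₁.dist_le_mul s ⟨hs.1, hst.trans htc⟩ t ⟨ht.1, htc⟩
    rcases le_total s c with hsc | hcs
    · have e₁ := h₁.dist_le_mul s ⟨hs.1, hsc⟩ c ⟨hs.1.trans hsc, le_rfl⟩
      have e₂ := h₂.dist_le_mul c ⟨le_rfl, hct.trans ht.2⟩ t ⟨hct, ht.2⟩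
      have e₃ : dist s t = dist s c + dist c t := by
        rw [Real.dist_eq, Real.dist_eq, Real.dist_eq, abs_of_nonpos (by linarith),
          abs_of_nonpos (by linarith), abs_of_nonpos (by linarith)]
        ring
      rw [e₃, mul_add]
      exact (dist_triangle _ _ _).trans (add_le_add e₁ e₂)
    · exact h₂.dist_le_mul s ⟨hcs, hs.2⟩ t ⟨hct, ht.2⟩
  refine LipschitzOnWith.of_dist_le_mul fun s hs t ht => ?_
  rcases le_total s t with h | h
  · exact key s hs t ht h
  · rw [dist_comm, dist_comm s]
    exact key t ht s hs h

section Paths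

variable {E X : Type*} [NormedAddCommGroup E] [NormedSpace ℝ E]
  [NormedAddCommGroup X] [NormedSpace ℝ X]

/-- Induction along a subdivision: a relation between parameters that is reflexive, transitive and
holds between the ends of each `C¹` piece holds between the ends of a piecewise `C¹` path. -/
theorem IsPiecewiseC1.induction {a b : ℝ} {γ : ℝ → X} (hγ : IsPiecewiseC1 a b γ)
    {Q : ℝ → ℝ → Prop} (refl : ∀ c, Q c c)
    (piece : ∀ c d, c < d → Icc c d ⊆ Icc a b → ContDiffOn ℝ 1 γ (Icc c d) → Q c d)
    (glue : ∀ c d e, c ≤ d → d ≤ e → Q c d → Q d e → Q c e) : Q a b := by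
  obtain ⟨m, t, rfl, rfl, ht⟩ := hγ
  have hmono : ∀ n k, n + k ≤ m → t n ≤ t (n + k) := by
    intro n k
    induction k with
    | zero => intro _; exact le_rfl
    | succ k ih => intro hk; exact (ih (by omega)).trans (ht (n + k) (by omega)).1.le
  have key : ∀ n ≤ m, Q (t 0) (t n) := by
    intro n
    induction n with
    | zero => intro _; exact refl _
    | succ n ih =>
      intro hn
      have h0 : t 0 ≤ t n := by simpa using hmono 0 n (by omega)
      have h1 : t (n + 1) ≤ t m := by
        simpa [Nat.add_sub_cancel' hn] using hmono (n + 1) (m - (n + 1)) (by omega)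
      exact glue _ _ _ h0 (ht n (by omega)).1.le (ih (by omega))
        (piece _ _ (ht n (by omega)).1 (Icc_subset_Icc h0 h1) (ht n (by omega)).2)
  exact key m le_rfl

theorem IsPiecewiseC1.exists_lipschitzOnWith {a b : ℝ} {γ : ℝ → X} (hγ : IsPiecewiseC1 a b γ) :
    ∃ C, LipschitzOnWith C γ (Icc a b) := by
  refine hγ.induction (Q := fun a b => ∃ C, LipschitzOnWith C γ (Icc a b)) (fun c => ⟨0, ?_⟩)
    (fun c d _ _ h => h.exists_lipschitzOnWith one_ne_zero (convex_Icc c d) isCompact_Icc) ?_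
  · rw [Icc_self]
    exact LipschitzOnWith.of_dist_le_mul fun s hs t ht => by
      rw [mem_singleton_iff.1 hs, mem_singleton_iff.1 ht]; simp
  · rintro c d e - - ⟨C₁, h₁⟩ ⟨C₂, h₂⟩
    exact ⟨max C₁ C₂, (h₁.weaken (le_max_left _ _)).Icc_union (h₂.weaken (le_max_right _ _))⟩

theorem IsPiecewiseC1.exists_finite_differentiableAt {a b : ℝ} {γ : ℝ → X}
    (hγ : IsPiecewiseC1 a b γ) :
    ∃ S : Set ℝ, S.Finite ∧ ∀ t ∈ Ioo a b \ S, DifferentiableAt ℝ γ t := by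
  refine hγ.induction
    (Q := fun a b => ∃ S : Set ℝ, S.Finite ∧ ∀ t ∈ Ioo a b \ S, DifferentiableAt ℝ γ t)
    (fun c => ⟨∅, finite_empty, by simp⟩) ?_ ?_
  · intro c d _ _ h
    exact ⟨∅, finite_empty, fun t ht =>
      (h.differentiableOn one_ne_zero t (Ioo_subset_Icc_self ht.1)).differentiableAt
        (Icc_mem_nhds ht.1.1 ht.1.2)⟩
  · rintro c d e - - ⟨S₁, f₁, h₁⟩ ⟨S₂, f₂, h₂⟩
    refine ⟨insert d (S₁ ∪ S₂), (f₁.union f₂).insert d, fun t ht => ?_⟩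
    simp only [Set.mem_sdiff, mem_insert_iff, mem_union, not_or] at ht
    rcases lt_or_gt_of_ne ht.2.1 with h | h
    · exact h₁ t ⟨⟨ht.1.1, h⟩, ht.2.2.1⟩
    · exact h₂ t ⟨⟨h, ht.1.2⟩, ht.2.2.2⟩

variable {ω : X → (X →L[ℝ] (E →L[ℝ] E))} {a b : ℝ} {γ : ℝ → X}

theorem IsParallelAlong.add_const_smul {σ₁ σ₂ : ℝ → E} (h₁ : IsParallelAlong ω a b γ σ₁)
    (h₂ : IsParallelAlong ω a b γ σ₂) (c : ℝ) :
    IsParallelAlong ω a b γ (fun t => σ₁ t + c • σ₂ t) := by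
  obtain ⟨c₁, S₁, f₁, d₁⟩ := h₁
  obtain ⟨c₂, S₂, f₂, d₂⟩ := h₂
  refine ⟨c₁.add (c₂.const_smul c), S₁ ∪ S₂, f₁.union f₂, fun t ht => ?_⟩
  simp only [Set.mem_sdiff, mem_union, not_or] at ht
  have e : -(ω (γ t) (deriv γ t) (σ₁ t + c • σ₂ t))
      = -(ω (γ t) (deriv γ t) (σ₁ t)) + c • -(ω (γ t) (deriv γ t) (σ₂ t)) := by
    rw [map_add, map_smul, neg_add, smul_neg]
  rw [e]
  exact (d₁ t ⟨ht.1, ht.2.1⟩).add ((d₂ t ⟨ht.1, ht.2.2⟩).const_smul c)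

theorem IsParallelAlong.glue {c : ℝ} (hac : a ≤ c) (hcb : c ≤ b) {σ₁ σ₂ : ℝ → E}
    (h₁ : IsParallelAlong ω a c γ σ₁) (h₂ : IsParallelAlong ω c b γ σ₂) (h : σ₁ c = σ₂ c) :
    IsParallelAlong ω a b γ (fun t => if t ≤ c then σ₁ t else σ₂ t) := by
  obtain ⟨c₁, S₁, f₁, d₁⟩ := h₁
  obtain ⟨c₂, S₂, f₂, d₂⟩ := h₂
  refine ⟨?_, insert c (S₁ ∪ S₂), (f₁.union f₂).insert c, fun t ht => ?_⟩
  · rw [← Icc_union_Icc_eq_Icc hac hcb]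
    refine ContinuousOn.union_of_isClosed (c₁.congr fun t ht => if_pos ht.2)
      (c₂.congr fun t ht => ?_) isClosed_Icc isClosed_Icc
    rcases ht.1.eq_or_lt with rfl | hlt
    · simp [h]
    · exact if_neg hlt.not_ge
  · simp only [Set.mem_sdiff, mem_insert_iff, mem_union, not_or] at ht
    rcases lt_or_gt_of_ne ht.2.1 with hlt | hlt
    · simp only [if_pos hlt.le]
      refine (d₁ t ⟨⟨ht.1.1, hlt⟩, ht.2.2.1⟩).congr_of_eventuallyEq ?_
      filter_upwards [Iio_mem_nhds hlt] with s hs using if_pos (le_of_lt hs)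
    · simp only [if_neg hlt.not_ge]
      refine (d₂ t ⟨⟨hlt, ht.1.2⟩, ht.2.2.2⟩).congr_of_eventuallyEq ?_
      filter_upwards [Ioi_mem_nhds hlt] with s hs using if_neg (not_le.2 hs)

theorem exists_isParallelAlong_of_contDiffOn [CompleteSpace E] {c d : ℝ} (hcd : c < d)
    (hγ : ContDiffOn ℝ 1 γ (Icc c d)) (hω : ContinuousOn (fun t => ω (γ t)) (Icc c d)) (v : E) :
    ∃ σ : ℝ → E, IsParallelAlong ω c d γ σ ∧ σ c = v := by
  -- The coefficient on `[c, d]`, extended to the line by its values at the ends.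
  let A : ℝ → E →L[ℝ] E := fun t => -(ω (γ t) (derivWithin γ (Icc c d) t))
  have hA : ContinuousOn A (Icc c d) :=
    (hω.clm_apply (hγ.continuousOn_derivWithin (uniqueDiffOn_Icc hcd) le_rfl)).neg
  obtain ⟨K, hK⟩ := isCompact_Icc.exists_bound_of_continuousOn hA
  have hA' : Continuous fun t => A (projIcc c d hcd.le t) :=
    (continuousOn_iff_continuous_domRestrict.1 hA).comp continuous_projIcc
  obtain ⟨σ, hσ₀, hσ⟩ := exists_hasDerivAt_linear hA' (fun t => hK _ (Subtype.coe_prop _)) c v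
  refine ⟨σ, ⟨fun t _ => (hσ t).continuousAt.continuousWithinAt, ∅, finite_empty, fun t ht => ?_⟩,
    hσ₀⟩
  have h := hσ t
  rw [projIcc_of_mem hcd.le (Ioo_subset_Icc_self ht.1)] at h
  rw [← derivWithin_of_mem_nhds (Icc_mem_nhds ht.1.1 ht.1.2)]
  exact h

theorem IsPiecewiseC1.exists_isParallelAlong [CompleteSpace E] (hγ : IsPiecewiseC1 a b γ)
    (hω : ContinuousOn (fun t => ω (γ t)) (Icc a b)) (v : E) :
    ∃ σ : ℝ → E, IsParallelAlong ω a b γ σ ∧ σ a = v := by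
  refine hγ.induction
    (Q := fun c d => ∀ v : E, ∃ σ : ℝ → E, IsParallelAlong ω c d γ σ ∧ σ c = v) ?_ ?_ ?_ v
  · exact fun c v => ⟨fun _ => v, ⟨continuousOn_const, ∅, finite_empty, by simp⟩, rfl⟩
  · exact fun c d hcd hsub h v => exists_isParallelAlong_of_contDiffOn hcd h (hω.mono hsub) v
  · intro c d e hcd hde h₁ h₂ v
    obtain ⟨σ₁, p₁, rfl⟩ := h₁ v
    obtain ⟨σ₂, p₂, e₂⟩ := h₂ (σ₁ d)
    exact ⟨_, p₁.glue hcd hde p₂ e₂.symm, if_pos hcd⟩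

/-- A bound for the final values of all parallel sections in terms of their initial values makes
parallel transport well defined and bounded. -/
theorem exists_isParallelTransport_norm_le
    (hex : ∀ v : E, ∃ σ : ℝ → E, IsParallelAlong ω a b γ σ ∧ σ a = v) {C : ℝ} (hC : 0 ≤ C)
    (hbd : ∀ σ : ℝ → E, IsParallelAlong ω a b γ σ → ‖σ b‖ ≤ C * ‖σ a‖) :
    ∃ P : E →L[ℝ] E, IsParallelTransport ω a b γ P ∧ ‖P‖ ≤ C := by
  choose s hs hsa using hex
  have huniq : ∀ σ₁ σ₂ : ℝ → E, IsParallelAlong ω a b γ σ₁ → IsParallelAlong ω a b γ σ₂ →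
      σ₁ a = σ₂ a → σ₁ b = σ₂ b := by
    intro σ₁ σ₂ h₁ h₂ h
    have := hbd _ (h₁.add_const_smul h₂ (-1))
    simp only [h, neg_smul, one_smul, add_neg_cancel, norm_zero, mul_zero] at this
    simpa [add_neg_eq_zero] using this
  have hadd : ∀ (c : ℝ) (v w : E), s (v + c • w) b = s v b + c • s w b := fun c v w =>
    huniq _ _ (hs _) ((hs v).add_const_smul (hs w) c) (by simp only [hsa])
  have h0 : s 0 b = 0 := by
    have := hbd _ (hs 0)
    simpa [hsa] using this
  let P : E →ₗ[ℝ] E :=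
    { toFun := fun v => s v b
      map_add' := fun v w => by simpa using hadd 1 v w
      map_smul' := fun c v => by simpa [h0] using hadd c 0 v }
  have hP : ∀ v, ‖P v‖ ≤ C * ‖v‖ := fun v => by
    have := hbd _ (hs v)
    rwa [hsa] at this
  exact ⟨P.mkContinuous C hP, ⟨fun v => ⟨s v, hs v, hsa v⟩,
    fun σ hσ => huniq _ _ (hs _) hσ (hsa _)⟩, P.mkContinuous_norm_le hC hP⟩

end Paths

/-! ### The variation function of a Lipschitz path -/

section Variation

variable {Y : Type*} [PseudoMetricSpace Y] {f : ℝ → Y} {C : NNReal} {a b : ℝ}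

theorem LipschitzOnWith.variationOnFromTo_le (hf : LipschitzOnWith C f (Icc a b)) {s t : ℝ}
    (hs : s ∈ Icc a b) (ht : t ∈ Icc a b) (hst : s ≤ t) :
    variationOnFromTo f (Icc a b) s t ≤ C * (t - s) := by
  rw [variationOnFromTo.eq_of_le _ _ hst]
  refine ENNReal.toReal_le_of_le_ofReal (mul_nonneg C.coe_nonneg (sub_nonneg.2 hst)) ?_
  have hsub : Icc s t ⊆ Icc a b := Icc_subset_Icc hs.1 ht.2
  rw [inter_eq_right.2 hsub]
  calc eVariationOn (f ∘ id) (Icc s t) ≤ C * eVariationOn id (Icc s t) :=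
        hf.comp_eVariationOn_le hsub
    _ = ENNReal.ofReal (C * (t - s)) := by
        rw [eVariationOn_id_Icc, ENNReal.ofReal_mul C.coe_nonneg, ENNReal.ofReal_coe_nnreal]

theorem LipschitzOnWith.dist_le_variationOnFromTo (hf : LipschitzOnWith C f (Icc a b)) {s t : ℝ}
    (hs : s ∈ Icc a b) (ht : t ∈ Icc a b) (hst : s ≤ t) :
    dist (f t) (f s) ≤ variationOnFromTo f (Icc a b) s t := by
  rw [variationOnFromTo.eq_of_le _ _ hst, dist_edist]
  exact ENNReal.toReal_mono (hf.locallyBoundedVariationOn s t hs ht)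
    (eVariationOn.edist_le f ⟨ht, hst, le_rfl⟩ ⟨hs, le_rfl, hst⟩)

theorem LipschitzOnWith.continuousOn_variationOnFromTo (hf : LipschitzOnWith C f (Icc a b)) :
    ContinuousOn (variationOnFromTo f (Icc a b) a) (Icc a b) := by
  have key : ∀ s ∈ Icc a b, ∀ t ∈ Icc a b, s ≤ t →
      dist (variationOnFromTo f (Icc a b) a s) (variationOnFromTo f (Icc a b) a t)
        ≤ C * dist s t := by
    intro s hs t ht hst
    have ha : a ∈ Icc a b := ⟨le_rfl, hs.1.trans hs.2⟩
    rw [dist_comm, dist_comm s, Real.dist_eq,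
      variationOnFromTo.sub_right hf.locallyBoundedVariationOn ha ht hs,
      abs_of_nonneg (variationOnFromTo.nonneg_of_le _ _ hst), Real.dist_eq,
      abs_of_nonneg (sub_nonneg.2 hst)]
    exact hf.variationOnFromTo_le hs ht hst
  refine (LipschitzOnWith.of_dist_le_mul (K := C) fun s hs t ht => ?_).continuousOn
  rcases le_total s t with h | h
  · exact key s hs t ht h
  · rw [dist_comm, dist_comm s]
    exact key t ht s hs h

end Variation

/-! ### Transport in the direction of `ℝ` and the growth of parallel sections -/

section Gauge

variable {E F : Type*} [NormedAddCommGroup E] [NormedSpace ℝ E]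
  [NormedAddCommGroup F] [NormedSpace ℝ F]

/-- The coefficient `ω₂(x, s)(1)` of the connection in the direction of `ℝ`. -/
noncomputable def verticalCoeff (ω : F × ℝ → (F × ℝ →L[ℝ] (E →L[ℝ] E))) (x : F) (s : ℝ) :
    E →L[ℝ] E :=
  ω (x, s) (0, 1)

theorem norm_verticalCoeff_le {ω : F × ℝ → (F × ℝ →L[ℝ] (E →L[ℝ] E))} {x : F} {s B : ℝ}
    (h : ‖ω (x, s)‖ ≤ B) : ‖verticalCoeff ω x s‖ ≤ B := by
  refine ((ω (x, s)).le_opNorm _).trans ?_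
  have : ‖((0, 1) : F × ℝ)‖ = 1 := by simp [Prod.norm_def]
  rw [this, mul_one]
  exact h

theorem norm_verticalCoeff_sub_le {M : Set F} {J : Set ℝ} (hM : IsOpen M) (hJ : IsOpen J)
    {ω : F × ℝ → (F × ℝ →L[ℝ] (E →L[ℝ] E))} (hω : ContDiffOn ℝ 1 ω (M ×ˢ J)) {B' : ℝ}
    (hB' : ∀ p ∈ M ×ˢ J, ‖partialSecondComponent ω p‖ ≤ B') {x y : F} {ε : ℝ}
    (hε : Metric.ball x ε ⊆ M) (hy : y ∈ Metric.ball x ε) {s : ℝ} (hs : s ∈ J) :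
    ‖verticalCoeff ω y s - verticalCoeff ω x s‖ ≤ B' * ‖y - x‖ := by
  have hx : x ∈ Metric.ball x ε := Metric.mem_ball_self (Metric.nonempty_ball.1 ⟨y, hy⟩)
  have hdiff : ∀ z ∈ Metric.ball x ε,
      DifferentiableAt ℝ (fun z : F => secondComponent ω (z, s)) z := by
    intro z hz
    have h1 : DifferentiableAt ℝ ω (z, s) :=
      (hω.differentiableOn one_ne_zero _ ⟨hε hz, hs⟩).differentiableAt
        ((hM.prod hJ).mem_nhds ⟨hε hz, hs⟩)
    have h2 : DifferentiableAt ℝ (fun z : F => ω (z, s)) z :=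
      DifferentiableAt.comp z (f := fun z : F => (z, s)) h1 (by fun_prop)
    exact h2.clm_comp (differentiableAt_const _)
  have h := (convex_ball x ε).norm_image_sub_le_of_norm_fderiv_le (𝕜 := ℝ) hdiff
    (fun z hz => hB' (z, s) ⟨hε hz, hs⟩) hx hy
  have e : ∀ z, verticalCoeff ω z s = secondComponent ω (z, s) 1 := fun z => rfl
  rw [e, e, ← _root_.sub_apply]
  refine (ContinuousLinearMap.le_opNorm _ _).trans ?_
  rwa [norm_one, mul_one]

/-- A local gauge that kills the component `ω₂` over `M × [p, q]`: the operators `H x s` move the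
fiber over `(x, s)` to the fiber over `(x, p)` by parallel transport along `{x} × [p, s]`. Only
their Lipschitz dependence on `x` is recorded, which avoids differentiating a flow with respect
to its parameters. -/
theorem exists_verticalGauge [CompleteSpace E] {M : Set F} {J : Set ℝ} (hM : IsOpen M)
    (hJ : IsOpen J) {ω : F × ℝ → (F × ℝ →L[ℝ] (E →L[ℝ] E))} (hω : ContDiffOn ℝ 1 ω (M ×ˢ J))
    {B B' ℓ : ℝ} (hB1 : 1 ≤ B) (hB : ∀ p ∈ M ×ˢ J, ‖ω p‖ ≤ B)
    (hB' : ∀ p ∈ M ×ˢ J, ‖partialSecondComponent ω p‖ ≤ B') {p q : ℝ} (hpq : p ≤ q)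
    (hJpq : Icc p q ⊆ J) (hℓ : q - p ≤ ℓ) :
    ∃ H : F → ℝ → E →L[ℝ] E,
      (∀ x ∈ M, ∀ s ∈ Icc p q, HasDerivAt (H x) (H x s * verticalCoeff ω x s) s) ∧
      (∀ x ∈ M, ∀ s ∈ Icc p q, ‖H x s‖ ≤ Real.exp (B * ℓ)) ∧
      (∀ x ∈ M, ∀ s ∈ Icc p q, ∀ v, ‖v‖ ≤ Real.exp (B * ℓ) * ‖H x s v‖) ∧
      (∀ x ∈ M, ∀ᶠ y in 𝓝 x, ∀ s ∈ Icc p q,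
        ‖H y s - H x s‖ ≤ Real.exp (B * ℓ) ^ 2 * B' * ‖y - x‖) := by
  -- Clamping the parameter to `[p, q]` makes the coefficient continuous and bounded on `ℝ`.
  let A : F → ℝ → E →L[ℝ] E := fun x s => verticalCoeff ω x (projIcc p q hpq s)
  have hA : ∀ x ∈ M, Continuous (A x) := by
    intro x hx
    have h1 : ContinuousOn (fun s => verticalCoeff ω x s) (Icc p q) := by
      refine ContinuousOn.clm_apply (hω.continuousOn.comp (by fun_prop) fun s hs => ?_)
        continuousOn_const
      exact ⟨hx, hJpq hs⟩
    exact (continuousOn_iff_continuous_domRestrict.1 h1).comp continuous_projIcc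
  have hAB : ∀ x ∈ M, ∀ s, ‖A x s‖ ≤ B := fun x hx s =>
    norm_verticalCoeff_le (hB _ ⟨hx, hJpq (Subtype.coe_prop _)⟩)
  have hA_eq : ∀ x, ∀ s ∈ Icc p q, A x s = verticalCoeff ω x s := fun x s hs => by
    simp only [A, projIcc_of_mem hpq hs]
  have hex : ∀ x, ∃ h : ℝ → E →L[ℝ] E,
      x ∈ M → h p = 1 ∧ ∀ s, HasDerivAt h (h s * A x s) s := by
    intro x
    by_cases hx : x ∈ M
    · obtain ⟨h, hh⟩ := exists_hasDerivAt_mul_right (hA x hx) (hAB x hx) p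
      exact ⟨h, fun _ => hh⟩
    · exact ⟨0, fun h => (hx h).elim⟩
  choose H hH using hex
  have hexp : ∀ s ∈ Icc p q, Real.exp (B * (s - p)) ≤ Real.exp (B * ℓ) := by
    intro s hs
    gcongr
    linarith [hs.2]
  refine ⟨H, fun x hx s hs => ?_, fun x hx s hs => ?_, fun x hx s hs v => ?_, fun x hx => ?_⟩
  · rw [← hA_eq x s hs]
    exact (hH x hx).2 s
  · exact (norm_fundamental_le (hAB x hx) (hH x hx).1 (hH x hx).2 hs.1).trans (hexp s hs)
  · refine (norm_le_mul_norm_fundamental_apply (hA x hx) (hAB x hx) (hH x hx).1 (hH x hx).2 hs.1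
      v).trans ?_
    exact mul_le_mul_of_nonneg_right (hexp s hs) (norm_nonneg _)
  · obtain ⟨ε, hε, hεM⟩ := Metric.isOpen_iff.1 hM x hx
    filter_upwards [Metric.ball_mem_nhds x hε] with y hy s hs
    have hyM := hεM hy
    rw [mul_assoc]
    exact norm_fundamental_sub_le hB1 (hAB y hyM) (hAB x hx) (hH y hyM).1 (hH x hx).1
      (hH y hyM).2 (hH x hx).2 hs.1 (by linarith [hs.2]) fun t =>
        norm_verticalCoeff_sub_le hM hJ hω hB' hεM hy (hJpq (Subtype.coe_prop _))

/-- The infinitesimal growth estimate. In the gauge `H` a parallel section only feels the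
component of the velocity in `F`, so its norm, discounted by the exponential of the variation `V`
of that component, has nonpositive upper right derivative. -/
theorem eventually_slope_discounted_norm_lt {ω : F × ℝ → (F × ℝ →L[ℝ] (E →L[ℝ] E))}
    {γ : ℝ → F × ℝ} {σ : ℝ → E} {V : ℝ → ℝ} {H : F → ℝ → E →L[ℝ] E} {t e B C : ℝ}
    (he : 0 ≤ e) (hB : 0 ≤ B) (hC : 0 ≤ C)
    (hγ : DifferentiableAt ℝ γ t)
    (hσ : HasDerivAt σ (-(ω (γ t) (deriv γ t) (σ t))) t)
    (hωB : ‖ω (γ t)‖ ≤ B)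
    (hH : HasDerivAt (H (γ t).1) (H (γ t).1 (γ t).2 * verticalCoeff ω (γ t).1 (γ t).2) (γ t).2)
    (hHe : ‖H (γ t).1 (γ t).2‖ ≤ e) (hHinv : ‖σ t‖ ≤ e * ‖H (γ t).1 (γ t).2 (σ t)‖)
    (hLip : ∀ᶠ z in 𝓝[>] t,
      ‖H (γ z).1 (γ z).2 - H (γ t).1 (γ z).2‖ ≤ C * ‖(γ z).1 - (γ t).1‖)
    (hV : ∀ᶠ z in 𝓝[>] t, 0 ≤ V z ∧ ‖(γ z).1 - (γ t).1‖ ≤ V z - V t) {r : ℝ} (hr : 0 < r) :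
    ∀ᶠ z in 𝓝[>] t, slope (fun z => ‖H (γ z).1 (γ z).2 (σ z)‖
      * Real.exp (-((e * B + C) * e * V z))) t z < r := by
  set x := (γ t).1 with hx
  set s := (γ t).2 with hs
  set K := (e * B + C) * e with hK
  have hK0 : 0 ≤ K := by positivity
  have hγ1 : HasDerivAt (fun z => (γ z).1) (deriv γ t).1 t := hγ.hasDerivAt.fst
  have hγ2 : HasDerivAt (fun z => (γ z).2) (deriv γ t).2 t := hγ.hasDerivAt.snd
  -- `L ξ` is the change of the section in the gauge caused by the velocity `ξ` in `F`.
  let L : F →L[ℝ] E := (H x s).comp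
    (((ω (γ t)).comp (ContinuousLinearMap.inl ℝ F ℝ)).flip (σ t))
  have hL_apply : ∀ ξ, L ξ = H x s (ω (γ t) (ξ, 0) (σ t)) := fun ξ => rfl
  have hL_norm : ∀ ξ, ‖L ξ‖ ≤ e * B * ‖σ t‖ * ‖ξ‖ := by
    intro ξ
    have h1 : ‖((ξ, 0) : F × ℝ)‖ = ‖ξ‖ := by simp [Prod.norm_def]
    calc ‖L ξ‖ ≤ ‖H x s‖ * ‖ω (γ t) (ξ, 0) (σ t)‖ := (H x s).le_opNorm _
      _ ≤ e * (‖ω (γ t) (ξ, 0)‖ * ‖σ t‖) := by gcongr; exact ContinuousLinearMap.le_opNorm _ _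
      _ ≤ e * (B * ‖ξ‖ * ‖σ t‖) := by
          gcongr
          refine ((ω (γ t)).le_opNorm _).trans ?_
          rw [h1]
          gcongr
      _ = _ := by ring
  let ψ : ℝ → E := fun z => H x (γ z).2 (σ z)
  have hψ : HasDerivAt (fun z => ψ z + L (γ z).1) 0 t := by
    have h1 : HasDerivAt (fun z => H x (γ z).2) ((deriv γ t).2 • (H x s * verticalCoeff ω x s)) t :=
      HasDerivAt.scomp t hH hγ2
    have h2 := (h1.clm_apply hσ).add (L.hasFDerivAt.comp_hasDerivAt t hγ1)
    have hsplit : ω (γ t) (deriv γ t)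
        = ω (γ t) ((deriv γ t).1, 0) + (deriv γ t).2 • verticalCoeff ω x s := by
      have : deriv γ t = ((deriv γ t).1, 0) + (deriv γ t).2 • ((0, 1) : F × ℝ) := by
        ext <;> simp
      conv_lhs => rw [this, map_add, map_smul]
      rfl
    have h0 : ((deriv γ t).2 • (H x s * verticalCoeff ω x s)) (σ t)
        + H x (γ t).2 (-(ω (γ t) (deriv γ t) (σ t))) + L (deriv γ t).1 = 0 := by
      rw [hL_apply, hsplit, ← hs]
      simp
    rw [h0] at h2
    exact h2
  have hR1 := (hasDerivAt_iff_isLittleO.1 hψ).norm_left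
  have hR2 : (fun z => C * (‖(γ z).1 - x‖ * ‖σ z - σ t‖)) =o[𝓝 t] fun z => z - t := by
    have h1 : (fun z => ‖(γ z).1 - x‖) =O[𝓝 t] fun z => z - t := hγ1.isBigO_sub.norm_left
    have h2 : (fun z => ‖σ z - σ t‖) =o[𝓝 t] fun _ => (1 : ℝ) := by
      rw [Asymptotics.isLittleO_one_iff]
      have := (hσ.continuousAt.sub (continuousAt_const (y := σ t))).norm
      simpa [ContinuousAt] using this
    simpa using (h1.mul_isLittleO h2).const_mul_left C
  have hR := (hR1.add hR2).bound (half_pos hr)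
  filter_upwards [hR.filter_mono nhdsWithin_le_nhds, hLip, hV, self_mem_nhdsWithin]
    with z hz hzL hzV hzt
  rw [mem_Ioi] at hzt
  have hzt' : 0 < z - t := sub_pos.2 hzt
  simp only [smul_zero, sub_zero] at hz
  rw [Real.norm_of_nonneg hzt'.le] at hz
  replace hz := (le_abs_self _).trans hz
  set N := ‖H x s (σ t)‖ with hN
  set d := ‖(γ z).1 - x‖ with hd
  set R := ‖ψ z + L (γ z).1 - (ψ t + L x)‖ + C * (d * ‖σ z - σ t‖) with hRdef
  have hd0 : 0 ≤ d := norm_nonneg _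
  have hNz : ‖H (γ z).1 (γ z).2 (σ z)‖ ≤ N * (1 + K * (V z - V t)) + R := by
    have e1 : H (γ z).1 (γ z).2 (σ z) = (H (γ z).1 (γ z).2 - H x (γ z).2) (σ z)
        + ((ψ z + L (γ z).1 - (ψ t + L x)) + (H x s (σ t) - L ((γ z).1 - x))) := by
      have : ψ t = H x s (σ t) := rfl
      simp only [_root_.sub_apply, map_sub, this]
      simp only [ψ]
      abel
    have e2 : ‖(H (γ z).1 (γ z).2 - H x (γ z).2) (σ z)‖ ≤ C * d * (‖σ t‖ + ‖σ z - σ t‖) := by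
      refine (ContinuousLinearMap.le_opNorm _ _).trans ?_
      gcongr
      exact norm_le_norm_add_norm_sub' _ _
    have e3 : ‖H x s (σ t) - L ((γ z).1 - x)‖ ≤ N + e * B * ‖σ t‖ * d :=
      (norm_sub_le _ _).trans (add_le_add le_rfl (hL_norm _))
    have e4 : (e * B + C) * ‖σ t‖ * d ≤ (e * B + C) * (e * N) * (V z - V t) := by
      gcongr
      exact hzV.2
    rw [e1]
    refine (norm_add_le _ _).trans ((add_le_add e2 ((norm_add_le _ _).trans
      (add_le_add le_rfl e3))).trans ?_)
    rw [hRdef, hK]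
    linarith [e4]
  have hR0 : 0 ≤ R := by positivity
  have hexp1 : Real.exp (-(K * V z)) ≤ 1 :=
    Real.exp_le_one_iff.2 (neg_nonpos.2 (mul_nonneg hK0 hzV.1))
  have hexp2 : (1 + K * (V z - V t)) * Real.exp (-(K * V z)) ≤ Real.exp (-(K * V t)) := by
    have h1 := Real.add_one_le_exp (K * (V z - V t))
    calc (1 + K * (V z - V t)) * Real.exp (-(K * V z))
        ≤ Real.exp (K * (V z - V t)) * Real.exp (-(K * V z)) := by gcongr; linarith
      _ = Real.exp (-(K * V t)) := by rw [← Real.exp_add]; congr 1; ring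
  have hfin : ‖H (γ z).1 (γ z).2 (σ z)‖ * Real.exp (-(K * V z))
      ≤ N * Real.exp (-(K * V t)) + r / 2 * (z - t) := by
    calc ‖H (γ z).1 (γ z).2 (σ z)‖ * Real.exp (-(K * V z))
        ≤ (N * (1 + K * (V z - V t)) + R) * Real.exp (-(K * V z)) := by gcongr
      _ = N * ((1 + K * (V z - V t)) * Real.exp (-(K * V z))) + R * Real.exp (-(K * V z)) := by
          ring
      _ ≤ N * Real.exp (-(K * V t)) + R * 1 := by gcongr
      _ ≤ _ := by rw [mul_one]; gcongr
  rw [slope_def_field, div_lt_iff₀ hzt']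
  have : r / 2 * (z - t) < r * (z - t) := by gcongr; linarith
  linarith [hfin]

/-- The norm of a parallel section along `γ` grows at most exponentially in the length of the
projection of `γ` to `F`. -/
theorem IsParallelAlong.norm_le_exp_arcLength [CompleteSpace E] {M : Set F} {J : Set ℝ}
    (hM : IsOpen M) (hJ : IsOpen J) (hJc : J.OrdConnected)
    {ω : F × ℝ → (F × ℝ →L[ℝ] (E →L[ℝ] E))} (hω : ContDiffOn ℝ 1 ω (M ×ˢ J))
    {B B' ℓ : ℝ} (hB1 : 1 ≤ B) (hB : ∀ p ∈ M ×ˢ J, ‖ω p‖ ≤ B) (hB'0 : 0 ≤ B')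
    (hB' : ∀ p ∈ M ×ˢ J, ‖partialSecondComponent ω p‖ ≤ B')
    (hℓ : ∀ p ∈ J, ∀ q ∈ J, q - p ≤ ℓ) {a b : ℝ} (hab : a ≤ b) {γ : ℝ → F × ℝ}
    (hγ : IsPiecewiseC1 a b γ) (hγM : ∀ t ∈ Icc a b, γ t ∈ M ×ˢ J) {σ : ℝ → E}
    (hσ : IsParallelAlong ω a b γ σ) :
    ‖σ b‖ ≤ Real.exp (B * ℓ) ^ 2 * Real.exp ((Real.exp (B * ℓ) * B + Real.exp (B * ℓ) ^ 2 * B') *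
      Real.exp (B * ℓ) * arcLength a b (fun t => (γ t).1)) * ‖σ a‖ := by
  obtain ⟨C, hC⟩ := hγ.exists_lipschitzOnWith
  have hγc : ContinuousOn γ (Icc a b) := hC.continuousOn
  have hne : (Icc a b).Nonempty := nonempty_Icc.2 hab
  obtain ⟨tp, htp, hp⟩ := isCompact_Icc.exists_isMinOn hne hγc.snd
  obtain ⟨tq, htq, hq⟩ := isCompact_Icc.exists_isMaxOn hne hγc.snd
  have hmem : ∀ t ∈ Icc a b, (γ t).2 ∈ Icc (γ tp).2 (γ tq).2 := fun t ht => ⟨hp ht, hq ht⟩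
  obtain ⟨H, hHd, hHe, hHinv, hHLip⟩ := exists_verticalGauge hM hJ hω hB1 hB hB'
    ((hmem tp htp).2) (hJc.out (hγM tp htp).2 (hγM tq htq).2)
    (hℓ _ (hγM tp htp).2 _ (hγM tq htq).2)
  set e := Real.exp (B * ℓ) with he
  have he0 : 0 < e := Real.exp_pos _
  set c : ℝ → F := fun t => (γ t).1 with hc
  have hCc : LipschitzOnWith C c (Icc a b) := by
    simpa [Function.comp_def] using LipschitzWith.prod_fst.comp_lipschitzOnWith hC
  set V := variationOnFromTo c (Icc a b) a with hVdef
  set K := (e * B + e ^ 2 * B') * e with hK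
  have ha : a ∈ Icc a b := left_mem_Icc.2 hab
  have hb : b ∈ Icc a b := right_mem_Icc.2 hab
  have hGc : ContinuousOn (fun t => H (γ t).1 (γ t).2) (Icc a b) := by
    intro t ht
    have h1 : ContinuousWithinAt (fun z => H (γ t).1 (γ z).2) (Icc a b) t :=
      ContinuousAt.comp_continuousWithinAt (f := fun z => (γ z).2)
        (hHd _ (hγM t ht).1 _ (hmem t ht)).continuousAt (hγc t ht).snd
    have h2 : Tendsto (fun z => H (γ z).1 (γ z).2 - H (γ t).1 (γ z).2) (𝓝[Icc a b] t) (𝓝 0) := by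
      have hfst : Tendsto (fun z => (γ z).1) (𝓝[Icc a b] t) (𝓝 (γ t).1) := (hγc t ht).fst
      refine squeeze_zero_norm' (a := fun z => e ^ 2 * B' * ‖(γ z).1 - (γ t).1‖) ?_ ?_
      · filter_upwards [hfst.eventually (hHLip _ (hγM t ht).1), self_mem_nhdsWithin] with z hz hz'
        exact hz _ (hmem z hz')
      · simpa using ((hfst.sub_const (γ t).1).norm).const_mul (e ^ 2 * B')
    have h3 := h2.add h1
    simpa [ContinuousWithinAt] using h3
  obtain ⟨hσc, S₁, hS₁, hσd⟩ := hσ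
  obtain ⟨S₂, hS₂, hγd⟩ := hγ.exists_finite_differentiableAt
  have hVc : ContinuousOn V (Icc a b) := hCc.continuousOn_variationOnFromTo
  have hmain := le_of_frequently_slope_lt_off_finite (hS₁.union hS₂) hab
    (f := fun z => ‖H (γ z).1 (γ z).2 (σ z)‖ * Real.exp (-(K * V z)))
    ((hGc.clm_apply hσc).norm.mul
      (Real.continuous_exp.comp_continuousOn (hVc.const_smul K).neg)) (by
    intro t ht r hr
    have ht' : t ∈ Icc a b := Ioo_subset_Icc_self ht.1
    have hIcc : Icc a b ∈ 𝓝 t := Icc_mem_nhds ht.1.1 ht.1.2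
    have htM := hγM t ht'
    refine (eventually_slope_discounted_norm_lt he0.le (zero_le_one.trans hB1)
      (mul_nonneg (sq_nonneg e) hB'0) (hγd t ⟨ht.1, fun h => ht.2 (Or.inr h)⟩)
      (hσd t ⟨ht.1, fun h => ht.2 (Or.inl h)⟩) (hB _ htM) (hHd _ htM.1 _ (hmem t ht'))
      (hHe _ htM.1 _ (hmem t ht')) (hHinv _ htM.1 _ (hmem t ht') _) ?_ ?_ hr).frequently
    · have hfst : Tendsto (fun z => (γ z).1) (𝓝 t) (𝓝 (γ t).1) := (hγc.continuousAt hIcc).fst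
      filter_upwards [nhdsWithin_le_nhds (hfst.eventually (hHLip _ htM.1)),
        nhdsWithin_le_nhds hIcc] with z hz hz'
      exact hz _ (hmem z hz')
    · filter_upwards [nhdsWithin_le_nhds hIcc, self_mem_nhdsWithin] with z hz hzt
      refine ⟨variationOnFromTo.nonneg_of_le _ _ hz.1, ?_⟩
      rw [hVdef, variationOnFromTo.sub_right hCc.locallyBoundedVariationOn ha hz ht', ← dist_eq_norm]
      exact hCc.dist_le_variationOnFromTo ht' hz (le_of_lt hzt))
  have hVa : V a = 0 := variationOnFromTo.self _ _ _
  have hVb : V b = arcLength a b c := by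
    rw [hVdef, variationOnFromTo.eq_of_le _ _ hab, inter_self]; rfl
  simp only [hVa, hVb, mul_zero, neg_zero, Real.exp_zero, mul_one] at hmain
  rw [Real.exp_neg, ← div_eq_mul_inv, div_le_iff₀ (Real.exp_pos _)] at hmain
  calc ‖σ b‖ ≤ e * ‖H (γ b).1 (γ b).2 (σ b)‖ := hHinv _ (hγM b hb).1 _ (hmem b hb) _
    _ ≤ e * (‖H (γ a).1 (γ a).2 (σ a)‖ * Real.exp (K * arcLength a b c)) := by gcongr
    _ ≤ e * (e * ‖σ a‖ * Real.exp (K * arcLength a b c)) := by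
        gcongr
        refine (ContinuousLinearMap.le_opNorm _ _).trans ?_
        gcongr
        exact hHe _ (hγM a ha).1 _ (hmem a ha)
    _ = _ := by ring

end Gauge

/-! ### Parallel transport with bounded coefficients -/

theorem theorem4p4 {E F : Type*} [NormedAddCommGroup E] [NormedSpace ℝ E] [CompleteSpace E]
    [NormedAddCommGroup F] [NormedSpace ℝ F] [CompleteSpace F]
    (M : Set F) (hM : IsOpen M)
    (J : Set ℝ) (hJ_open : IsOpen J) (hJ_interval : J.OrdConnected)
    (hJ_bounded : Bornology.IsBounded J)
    (ω : F × ℝ → (F × ℝ →L[ℝ] (E →L[ℝ] E)))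
    (hω_C1 : ContDiffOn ℝ 1 ω (M ×ˢ J))
    (hω_bounded : ∃ B : ℝ, ∀ p ∈ M ×ˢ J, ‖ω p‖ ≤ B)
    (hω₂_bounded : ∃ B : ℝ, ∀ p ∈ M ×ˢ J, ‖partialSecondComponent ω p‖ ≤ B) :
    ∃ β : ℝ → ℝ, Monotone β ∧ ContDiff ℝ (⊤ : ℕ∞) β ∧ (∀ x, 0 < β x) ∧
      ∀ (a b : ℝ), a ≤ b → ∀ γ : ℝ → F × ℝ, IsPiecewiseC1 a b γ →
        (∀ t ∈ Icc a b, γ t ∈ M ×ˢ J) →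
          ∃ P : E →L[ℝ] E, IsParallelTransport ω a b γ P ∧
            ‖P‖ ≤ β (arcLength a b (fun t => (γ t).1)) := by
  obtain ⟨B₀, hB₀⟩ := hω_bounded
  obtain ⟨B₁, hB₁⟩ := hω₂_bounded
  have hB : ∀ p ∈ M ×ˢ J, ‖ω p‖ ≤ max B₀ 1 := fun p hp => (hB₀ p hp).trans (le_max_left _ _)
  have hB' : ∀ p ∈ M ×ˢ J, ‖partialSecondComponent ω p‖ ≤ max B₁ 0 :=
    fun p hp => (hB₁ p hp).trans (le_max_left _ _)
  have hℓ : ∀ p ∈ J, ∀ q ∈ J, q - p ≤ Metric.diam J := fun p hp q hq =>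
    (le_abs_self _).trans (Metric.dist_le_diam_of_mem hJ_bounded hq hp)
  set B := max B₀ 1
  set B' := max B₁ 0
  set e := Real.exp (B * Metric.diam J)
  have hB1 : 1 ≤ B := le_max_right _ _
  have hB'0 : 0 ≤ B' := le_max_right _ _
  refine ⟨fun x => e ^ 2 * Real.exp ((e * B + e ^ 2 * B') * e * x), ?_, ?_, ?_, ?_⟩
  · intro x y hxy
    have : 0 ≤ B := zero_le_one.trans hB1
    dsimp only
    gcongr
  · fun_prop
  · intro x
    positivity
  · intro a b hab γ hγ hγM
    have hωγ : ContinuousOn (fun t => ω (γ t)) (Icc a b) := by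
      obtain ⟨C, hC⟩ := hγ.exists_lipschitzOnWith
      exact hω_C1.continuousOn.comp hC.continuousOn hγM
    exact exists_isParallelTransport_norm_le (hγ.exists_isParallelAlong hωγ) (by positivity)
      fun σ hσ => hσ.norm_le_exp_arcLength hM hJ_open hJ_interval hω_C1 hB1 hB hB'0 hB' hℓ hab
        hγ hγM
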